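/- Theorem 1.3. Let $d\ge 1$. For a measure space $(\Omega,\mu)$, $0<p<\infty$ and $0<r\le\infty$, let $L^{p,r}(\mu)$ be the space of measurable $g$ with $$[g]_{L^{p,r}(\mu)}=\Big(r\int_0^\infty \lambda^r\,\mu(\{|g|>\lambda\})^{r/p}\,\tfrac{d\lambda}{\lambda}\Big)^{1/r}<\infty\quad(r<\infty),\qquad [g]_{L^{p,\infty}(\mu)}=\sup_{\lambda>0}\lambda\,\mu(\{|g|>\lambda\})^{1/p}<\infty .$$ Let $\mathcal S_\infty(\mathbb R^d)$ be the space of Schwartz functions whose Fourier transforms vanish to infinite order at $0$, with the topology inherited from $\mathcal S(\mathbb R^d)$, and let $\mathcal S_\infty'(\mathbb R^d)$ be its dual. Fix a radial $\varphi\in C_c^\infty(\mathbb R^d)$ with $\operatorname{supp}\varphi\subset\{3/4<|\xi|<7/4\}$, $\varphi(\xi)=1$ for $7/8\le|\xi|\le 9/8$ and $\sum_{k\in\mathbb Z}\varphi(2^{-k}\xi)=1$ for all $\xi\ne0$, and for $f\in\mathcal S_\infty'(\mathbb R^d)$ let $L_kf$ be the function given by $\widehat{L_kf}(\xi)=\varphi(2^{-k}\xi)\widehat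 f(\xi)$, where $\widehat f(\xi)=\int f(x)e^{-i\langle x,\xi\rangle}\,dx$; that is, $L_kf(x)=\langle f,K_k(x-\cdot)\rangle$ with $\widehat{K_k}=\varphi(2^{-k}\cdot)$. For $s,\gamma\in\mathbb R$, $1\le p<\infty$, $1\le r,q\le\infty$ define, as subspaces of $\mathcal S_\infty'(\mathbb R^d)$ on which the respective quasi-norm is finite: - $\dot{\mathcal B}^s_p(\gamma,r)$, with $\|f\|=\big[(x,k)\mapsto 2^{k(s+\gamma/p)}L_kf(x)\big]_{L^{p,r}(\mu_\gamma)}$, where $\mu_\gamma(E)=\sum_{k\in\mathbb Z}2^{-k\gamma}\int_{\mathbb R^d}\mathbf 1_E(x,k)\,dx$ on $\mathbb R^d\times\mathbb Z$; - $\dot B^s_q[L^{p,r}]$, with $\|f\|=\big(\sum_{k\in\mathbb Z}2^{ksq}[L_kf]_{L^{p,r}(\mathbb R^d)}^q\big)^{1/q}$; - $\dot F^s_{p,q}$, with $\|f\|=\big\|\big(\sum_{k\in\mathbb Z}2^{ksq}|L_kf|^q\big)^{1/q}\big\|_{L^p(\mathbb R^d)}$ (with suprema over $k$ if $q=\infty$).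 Write $X\hookrightarrow Y$ if $X\subseteq Y$ and $\|f\|_Y\le C\|f\|_X$ for all $f\in X$, with a finite constant $C$ independent of $f$. The following statements hold for all $s\in\mathbb R$ and $p\in[1,\infty)$. (i) For all $\gamma\in\mathbb R$, $$\dot{\mathcal B}^s_p(\gamma,r)\hookrightarrow\dot B^s_r[L^{p,r}]\quad\text{if } p\le r\le\infty,\qquad \dot B^s_r[L^{p,r}]\hookrightarrow\dot{\mathcal B}^s_p(\gamma,r)\quad\text{if } 1\le r\le p.$$ (ii) For all $\gamma\in\mathbb R$ with $\gamma\neq0$, $$\dot F^s_{p,r}\hookrightarrow\dot{\mathcal B}^s_p(\gamma,r)\quad\text{if } p\le r\le\infty,\qquad \dot{\mathcal B}^s_p(\gamma,r)\hookrightarrow\dot F^s_{p,r}\quad\text{if } 1\le r\le p.$$ -/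

import Mathlib

open MeasureTheory SchwartzMap
open scoped ENNReal NNReal FourierTransform ContDiff RealInnerProductSpace

noncomputable section

namespace LorentzBesov

/-! ### Lorentz spaces -/

section Lorentz

variable {α : Type*} [MeasurableSpace α]

/-- The distribution function `lam ↦ μ {|g| > lam}`. -/
def distribFn (g : α → ℂ) (μ : Measure α) (lam : ℝ) : ℝ≥0∞ :=
  μ {x | lam < ‖g x‖}

/-- The Lorentz quasi-norm
`[g]_{L^{p,r}(μ)} = (r ∫_0^∞ lam^r μ{|g| > lam}^{r/p} dlam/lam)^{1/r}` for `r < ∞`, and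
`[g]_{L^{p,∞}(μ)} = sup_{lam > 0} lam μ{|g| > lam}^{1/p}`. -/
def lorentzQNorm (g : α → ℂ) (p : ℝ) (r : ℝ≥0∞) (μ : Measure α) : ℝ≥0∞ :=
  if r = ⊤ then
    ⨆ lam ∈ Set.Ioi (0 : ℝ), ENNReal.ofReal lam * distribFn g μ lam ^ (1 / p)
  else
    (r * ∫⁻ lam in Set.Ioi (0 : ℝ),
      ENNReal.ofReal (lam ^ r.toReal) * distribFn g μ lam ^ (r.toReal / p)
        * ENNReal.ofReal (1 / lam)) ^ (1 / r.toReal)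

/-- Membership in `L^{p,r}(μ)`: measurable with finite Lorentz quasi-norm. -/
def MemLorentz (g : α → ℂ) (p : ℝ) (r : ℝ≥0∞) (μ : Measure α) : Prop :=
  AEStronglyMeasurable g μ ∧ lorentzQNorm g p r μ < ⊤

end Lorentz

/-- The `ℓ^q(ℤ)` (quasi-)norm of a sequence of nonnegative extended reals. -/
def lqNorm (q : ℝ≥0∞) (a : ℤ → ℝ≥0∞) : ℝ≥0∞ :=
  if q = ⊤ then ⨆ k, a k else (∑' k, a k ^ q.toReal) ^ (1 / q.toReal)

variable {d : ℕ}

/-! ### Schwartz functions with Fourier transform vanishing to infinite order at the origin -/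

/-- `𝒮_∞(ℝ^d)`: Schwartz functions all of whose Fourier transform's derivatives vanish at `0`.
It carries the subspace topology. -/
def SInfty (d : ℕ) : Submodule ℂ 𝓢(EuclideanSpace ℝ (Fin d), ℂ) where
  carrier := {f | ∀ n : ℕ,
    iteratedFDeriv ℝ n (𝓕 f : 𝓢(EuclideanSpace ℝ (Fin d), ℂ)) 0 = 0}
  zero_mem' := by
    intro n
    have h : (𝓕 (0 : 𝓢(EuclideanSpace ℝ (Fin d), ℂ)) : 𝓢(EuclideanSpace ℝ (Fin d), ℂ)) = 0 :=
      map_zero (FourierTransform.fourierCLM ℂ 𝓢(EuclideanSpace ℝ (Fin d), ℂ))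
    rw [h]
    exact congrFun (iteratedFDeriv_fun_zero (𝕜 := ℝ) (E := EuclideanSpace ℝ (Fin d))
      (F := ℂ) (n := n)) 0
  add_mem' := by
    intro f g hf hg n
    rw [FourierTransform.fourier_add, show
        ((𝓕 f + 𝓕 g : 𝓢(EuclideanSpace ℝ (Fin d), ℂ)) : EuclideanSpace ℝ (Fin d) → ℂ)
          = (𝓕 f : 𝓢(EuclideanSpace ℝ (Fin d), ℂ)) + (𝓕 g : 𝓢(EuclideanSpace ℝ (Fin d), ℂ))
        from rfl,
      iteratedFDeriv_add_apply ((𝓕 f : 𝓢(_, ℂ)).smooth n).contDiffAt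
        ((𝓕 g : 𝓢(_, ℂ)).smooth n).contDiffAt, hf n, hg n, add_zero]
  smul_mem' := by
    intro c f hf n
    rw [FourierTransform.fourier_smul, show
        ((c • 𝓕 f : 𝓢(EuclideanSpace ℝ (Fin d), ℂ)) : EuclideanSpace ℝ (Fin d) → ℂ)
          = c • (𝓕 f : 𝓢(EuclideanSpace ℝ (Fin d), ℂ)) from rfl,
      iteratedFDeriv_const_smul_apply ((𝓕 f : 𝓢(_, ℂ)).smooth n).contDiffAt, hf n, smul_zero]

/-- `𝒮_∞'(ℝ^d)`, the continuous dual of `𝒮_∞(ℝ^d)`. -/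
abbrev SInftyDual (d : ℕ) : Type := SInfty d →L[ℂ] ℂ

/-! ### Littlewood–Paley decomposition -/

/-- The radial smooth bump functions `φ` generating the homogeneous Littlewood–Paley
decomposition. -/
structure LPBump (d : ℕ) where
  toFun : EuclideanSpace ℝ (Fin d) → ℂ
  contDiff : ContDiff ℝ ∞ toFun
  radial : ∀ ξ η, ‖ξ‖ = ‖η‖ → toFun ξ = toFun η
  support_subset : tsupport toFun ⊆ {ξ | 3 / 4 < ‖ξ‖ ∧ ‖ξ‖ < 7 / 4}
  eq_one : ∀ ξ, 7 / 8 ≤ ‖ξ‖ → ‖ξ‖ ≤ 9 / 8 → toFun ξ = 1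
  hasSum : ∀ ξ, ξ ≠ 0 → HasSum (fun k : ℤ => toFun ((2 : ℝ) ^ (-k) • ξ)) 1

/-- The multiplier `φ(2^{-k} ·)` of `L_k`. The frequency variable of Mathlib's Fourier transform
`∫ f(y) e^{-2πi⟨y,ξ⟩} dy` is `1/(2π)` times the one of `∫ f(y) e^{-i⟨y,ξ⟩} dy`, for which the
decomposition is defined; hence the factor `2π`. -/
def LPBump.multiplier (φ : LPBump d) (k : ℤ) (ξ : EuclideanSpace ℝ (Fin d)) : ℂ :=
  φ.toFun ((2 : ℝ) ^ (-k) • (2 * Real.pi) • ξ)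

/-- The function `ξ ↦ e^{2πi⟨x,ξ⟩} φ(2^{-k} 2πξ)`. -/
def LPBump.modulated (φ : LPBump d) (k : ℤ) (x ξ : EuclideanSpace ℝ (Fin d)) : ℂ :=
  Complex.exp (((2 * Real.pi * ⟪x, ξ⟫ : ℝ) : ℂ) * Complex.I) * φ.multiplier k ξ

lemma LPBump.scale_pos (k : ℤ) : 0 < (2 : ℝ) ^ (-k) * (2 * Real.pi) := by
  have := Real.pi_pos
  positivity

lemma LPBump.multiplier_eq (φ : LPBump d) (k : ℤ) (ξ : EuclideanSpace ℝ (Fin d)) :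
    φ.multiplier k ξ = φ.toFun (((2 : ℝ) ^ (-k) * (2 * Real.pi)) • ξ) := by
  rw [LPBump.multiplier, smul_smul]

lemma LPBump.eq_zero_of_norm (φ : LPBump d) {ξ : EuclideanSpace ℝ (Fin d)}
    (h : ‖ξ‖ ≤ 3 / 4 ∨ 7 / 4 ≤ ‖ξ‖) : φ.toFun ξ = 0 := by
  by_contra h0
  have h1 := φ.support_subset (subset_tsupport _ (Function.mem_support.mpr h0))
  rcases h with h | h
  · exact absurd h1.1 (not_lt.mpr h)
  · exact absurd h1.2 (not_lt.mpr h)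

lemma LPBump.modulated_contDiff (φ : LPBump d) (k : ℤ) (x : EuclideanSpace ℝ (Fin d)) :
    ContDiff ℝ ∞ (φ.modulated k x) := by
  have h1 : ContDiff ℝ ∞ (fun ξ : EuclideanSpace ℝ (Fin d) =>
      Complex.exp (((2 * Real.pi * ⟪x, ξ⟫ : ℝ) : ℂ) * Complex.I)) := by
    apply ContDiff.cexp
    apply ContDiff.mul _ contDiff_const
    apply Complex.ofRealCLM.contDiff.comp
    exact contDiff_const.mul (contDiff_const.inner ℝ contDiff_id)
  have h2 : ContDiff ℝ ∞ (φ.multiplier k) := by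
    have : φ.multiplier k = fun ξ => φ.toFun (((2 : ℝ) ^ (-k) * (2 * Real.pi)) • ξ) :=
      funext (φ.multiplier_eq k)
    rw [this]
    exact φ.contDiff.comp (contDiff_const_smul _)
  exact h1.mul h2

lemma LPBump.modulated_hasCompactSupport (φ : LPBump d) (k : ℤ)
    (x : EuclideanSpace ℝ (Fin d)) : HasCompactSupport (φ.modulated k x) := by
  apply HasCompactSupport.intro
    (isCompact_closedBall (0 : EuclideanSpace ℝ (Fin d))
      (7 / 4 / ((2 : ℝ) ^ (-k) * (2 * Real.pi))))
  intro ξ hξ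
  have hs := LPBump.scale_pos k
  have h1 : 7 / 4 / ((2 : ℝ) ^ (-k) * (2 * Real.pi)) < ‖ξ‖ := by
    simpa [Metric.mem_closedBall] using hξ
  rw [div_lt_iff₀' hs] at h1
  rw [LPBump.modulated, LPBump.multiplier_eq, φ.eq_zero_of_norm, mul_zero]
  right
  rw [norm_smul, Real.norm_of_nonneg hs.le]
  exact h1.le

/-- `ξ ↦ e^{2πi⟨x,ξ⟩} φ(2^{-k} 2πξ)` as a Schwartz function. -/
def LPBump.modulatedSchwartz (φ : LPBump d) (k : ℤ) (x : EuclideanSpace ℝ (Fin d)) :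
    𝓢(EuclideanSpace ℝ (Fin d), ℂ) :=
  (φ.modulated_hasCompactSupport k x).toSchwartzMap (φ.modulated_contDiff k x)

lemma LPBump.modulated_eventually_zero (φ : LPBump d) (k : ℤ)
    (x : EuclideanSpace ℝ (Fin d)) :
    (fun ξ => φ.modulated k x (-ξ)) =ᶠ[nhds 0] fun _ => 0 := by
  have hs := LPBump.scale_pos k
  have hpos : 0 < 3 / 4 / ((2 : ℝ) ^ (-k) * (2 * Real.pi)) := by positivity
  filter_upwards [Metric.ball_mem_nhds (0 : EuclideanSpace ℝ (Fin d)) hpos] with ξ hξ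
  have h1 : ‖ξ‖ < 3 / 4 / ((2 : ℝ) ^ (-k) * (2 * Real.pi)) := by simpa using hξ
  rw [lt_div_iff₀' hs] at h1
  rw [LPBump.modulated, LPBump.multiplier_eq, φ.eq_zero_of_norm, mul_zero]
  left
  rw [norm_smul, norm_neg, Real.norm_of_nonneg hs.le]
  exact h1.le

/-- The convolution kernel `y ↦ K_k(x - y)` of `L_k`, where `K_k` is the inverse Fourier
transform of the multiplier (see `LPBump.kernel_apply`), as an element of `𝒮_∞`. -/
def LPBump.kernel (φ : LPBump d) (k : ℤ) (x : EuclideanSpace ℝ (Fin d)) : SInfty d :=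
  ⟨𝓕 (φ.modulatedSchwartz k x), by
    intro n
    have h : ((𝓕 (𝓕 (φ.modulatedSchwartz k x)) : 𝓢(EuclideanSpace ℝ (Fin d), ℂ)) :
        EuclideanSpace ℝ (Fin d) → ℂ) = fun ξ => φ.modulated k x (-ξ) := by
      funext ξ
      have h2 := congrArg (fun g : 𝓢(EuclideanSpace ℝ (Fin d), ℂ) => g (-ξ))
        (FourierTransform.fourierInv_fourier_eq
          (F := 𝓢(EuclideanSpace ℝ (Fin d), ℂ)) (φ.modulatedSchwartz k x))
      simp only [fourierInv_coe, Real.fourierInv_eq_fourier_neg, neg_neg] at h2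
      rw [fourier_coe]
      exact h2
    rw [h, ((φ.modulated_eventually_zero k x).iteratedFDeriv ℝ n).eq_of_nhds]
    exact congrFun (iteratedFDeriv_fun_zero (𝕜 := ℝ) (E := EuclideanSpace ℝ (Fin d))
      (F := ℂ) (n := n)) 0⟩

lemma LPBump.kernel_apply (φ : LPBump d) (k : ℤ) (x y : EuclideanSpace ℝ (Fin d)) :
    (φ.kernel k x : 𝓢(EuclideanSpace ℝ (Fin d), ℂ)) y = 𝓕⁻ (φ.multiplier k) (x - y) := by
  change (𝓕 (φ.modulatedSchwartz k x) : 𝓢(EuclideanSpace ℝ (Fin d), ℂ)) y = _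
  rw [fourier_coe, Real.fourier_eq', Real.fourierInv_eq']
  congr 1
  funext ξ
  change _ • (Complex.exp (((2 * Real.pi * ⟪x, ξ⟫ : ℝ) : ℂ) * Complex.I) *
    φ.multiplier k ξ) = _
  rw [smul_eq_mul, smul_eq_mul, ← mul_assoc, ← Complex.exp_add, inner_sub_right,
    real_inner_comm x ξ, real_inner_comm y ξ]
  congr 2
  push_cast
  ring

/-- The frequency localization `L_k f(x) = ⟨f, K_k(x - ·)⟩` of `f ∈ 𝒮_∞'`, i.e. the function
with `(L_k f)^(ξ) = φ(2^{-k} ξ) f^(ξ)`. -/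
def LPBump.L (φ : LPBump d) (f : SInftyDual d) (k : ℤ) (x : EuclideanSpace ℝ (Fin d)) : ℂ :=
  f (φ.kernel k x)

/-! ### The function spaces -/

/-- The measure `μ_γ(E) = ∑_k 2^{-kγ} ∫ 1_E(x,k) dx` on `ℝ^d × ℤ`. -/
def muGamma (d : ℕ) (γ : ℝ) : Measure (EuclideanSpace ℝ (Fin d) × ℤ) :=
  Measure.sum fun k : ℤ =>
    ENNReal.ofReal ((2 : ℝ) ^ (-(k : ℝ) * γ)) •
      (volume : Measure (EuclideanSpace ℝ (Fin d))).map (fun x => (x, k))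

/-- `P^b f (x,k) = 2^{kb} L_k f(x)`. -/
def LPBump.P (φ : LPBump d) (b : ℝ) (f : SInftyDual d) :
    EuclideanSpace ℝ (Fin d) × ℤ → ℂ :=
  fun z => (((2 : ℝ) ^ ((z.2 : ℝ) * b) : ℝ) : ℂ) * φ.L f z.2 z.1

/-- A subspace of `𝒮_∞'` together with its quasi-norm. -/
structure DistSpace (d : ℕ) where
  carrier : Set (SInftyDual d)
  qnorm : SInftyDual d → ℝ≥0∞

/-- The continuous embedding `X ↪ Y`: inclusion with control of the quasi-norm. -/
def DistSpace.Embeds (X Y : DistSpace d) : Prop :=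
  X.carrier ⊆ Y.carrier ∧ ∃ C : ℝ≥0, ∀ f ∈ X.carrier, Y.qnorm f ≤ C * X.qnorm f

/-- The space `ℬ̇^s_p(γ,r)`, with `‖f‖ = ‖P^{s+γ/p} f‖_{L^{p,r}(μ_γ)}`. -/
def LPBump.calB (φ : LPBump d) (s p γ : ℝ) (r : ℝ≥0∞) : DistSpace d where
  carrier := {f | MemLorentz (φ.P (s + γ / p) f) p r (muGamma d γ)}
  qnorm f := lorentzQNorm (φ.P (s + γ / p) f) p r (muGamma d γ)

/-- The `Ḃ^s_q[L^{p,r}]` quasi-norm `(∑_k 2^{ksq} ‖L_k f‖_{L^{p,r}}^q)^{1/q}`. -/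
def LPBump.besovQNorm (φ : LPBump d) (s : ℝ) (q : ℝ≥0∞) (p : ℝ) (r : ℝ≥0∞)
    (f : SInftyDual d) : ℝ≥0∞ :=
  lqNorm q fun k => ENNReal.ofReal ((2 : ℝ) ^ ((k : ℝ) * s)) * lorentzQNorm (φ.L f k) p r volume

/-- The Besov–Lorentz space `Ḃ^s_q[L^{p,r}]`. -/
def LPBump.besov (φ : LPBump d) (s : ℝ) (q : ℝ≥0∞) (p : ℝ) (r : ℝ≥0∞) : DistSpace d where
  carrier := {f | (∀ k, MemLorentz (φ.L f k) p r volume) ∧ φ.besovQNorm s q p r f < ⊤}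
  qnorm := φ.besovQNorm s q p r

/-- The function `(∑_k 2^{ksq} |L_k f(x)|^q)^{1/q}` (a supremum if `q = ∞`). -/
def LPBump.tlFun (φ : LPBump d) (s : ℝ) (q : ℝ≥0∞) (f : SInftyDual d)
    (x : EuclideanSpace ℝ (Fin d)) : ℝ≥0∞ :=
  lqNorm q fun k => ENNReal.ofReal ((2 : ℝ) ^ ((k : ℝ) * s)) * ‖φ.L f k x‖ₑ

/-- The Triebel–Lizorkin space `Ḟ^s_{p,q}`, with
`‖f‖ = ‖(∑_k 2^{ksq} |L_k f|^q)^{1/q}‖_{L^p}`. -/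
def LPBump.triebelLizorkin (φ : LPBump d) (s p : ℝ) (q : ℝ≥0∞) : DistSpace d where
  carrier := {f | MemLp (φ.tlFun s q f) (ENNReal.ofReal p) volume}
  qnorm f := eLpNorm (φ.tlFun s q f) (ENNReal.ofReal p) volume

end LorentzBesov

end

open MeasureTheory SchwartzMap
open scoped ENNReal NNReal FourierTransform ContDiff RealInnerProductSpace

noncomputable section

namespace LorentzBesov

/-! Write `P = P^{s+γ/p} f`, `t = r/p` and, for finite `r`, `dν = r lam^{r-1} dlam`. The weights are
arranged so that `(2^{-kγ})^{1/p} 2^{k(s+γ/p)} = 2^{ks}`; thus `γ` drops out of the Besov and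
Triebel–Lorizkin sides and can be reinserted at will.

(i) With `a_k(lam) = 2^{-kγ} |{|P(·,k)| > lam}|`, the `r`-th powers of the two quasi-norms are `∫ (∑
a_k)^t dν` and `∫ ∑ a_k^t dν`. They are compared pointwise in `lam` by `ℓ^1` against `ℓ^t`, with
constant 1.

(ii) Let `S(x,lam)` be the sum of `2^{-kγ}` over the `k` with `|P(x,k)| > lam` (`levelSum`). As `γ ≠
0`, such a sum is comparable to its largest term, so `S^t` is comparable to the sum of the
`2^{-kγt}`, whose `ν`-integral is exactly the `r`-th power of `tlFun` at `x`. Up to constants, the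
`p`-th powers of the quasi-norms are then `(∫ (∫ S dx)^t dν)^{1/t}` and `∫ (∫ S^t dν)^{1/t} dx`.
Minkowski's inequality orders them one way for `t ≥ 1` and the other way for `t ≤ 1`. For `r = ∞`
the comparison is pointwise in `x`. -/

/-! ### Inequalities for sums and integrals -/

theorem tsum_rpow_le_rpow_tsum {ι : Type*} (a : ι → ℝ≥0∞) {q : ℝ} (hq : 1 ≤ q) :
    ∑' i, a i ^ q ≤ (∑' i, a i) ^ q := by
  refine ENNReal.summable.tsum_le_of_sum_le fun s => ?_
  refine le_trans ?_ (ENNReal.rpow_le_rpow (ENNReal.sum_le_tsum s) (by linarith))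
  classical
  induction s using Finset.induction_on with
  | empty => simp
  | insert i s hi ih =>
    rw [Finset.sum_insert hi, Finset.sum_insert hi]
    exact (add_le_add le_rfl ih).trans (ENNReal.add_rpow_le_rpow_add _ _ hq)

theorem rpow_tsum_le_tsum_rpow {ι : Type*} (a : ι → ℝ≥0∞) {q : ℝ} (hq0 : 0 < q) (hq : q ≤ 1) :
    (∑' i, a i) ^ q ≤ ∑' i, a i ^ q := by
  have h := tsum_rpow_le_rpow_tsum (fun i => a i ^ q) (one_le_inv_iff₀.mpr ⟨hq0, hq⟩)
  simp only [ENNReal.rpow_rpow_inv hq0.ne'] at h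
  calc (∑' i, a i) ^ q ≤ ((∑' i, a i ^ q) ^ q⁻¹) ^ q := ENNReal.rpow_le_rpow h hq0.le
    _ = _ := ENNReal.rpow_inv_rpow hq0.ne' _

/-- **Minkowski's integral inequality**. -/
theorem lintegral_rpow_lintegral_le {α β : Type*} [MeasurableSpace α] [MeasurableSpace β]
    {μ : Measure α} {ν : Measure β} [SigmaFinite μ] [SFinite ν] {H : α → β → ℝ≥0∞}
    (hH : Measurable (Function.uncurry H)) {q : ℝ} (hq : 1 ≤ q) :
    (∫⁻ x, (∫⁻ y, H x y ∂ν) ^ q ∂μ) ^ (1 / q) ≤ ∫⁻ y, (∫⁻ x, H x y ^ q ∂μ) ^ (1 / q) ∂ν := by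
  rcases hq.eq_or_lt with rfl | hq1
  · simp only [ENNReal.rpow_one, div_one]
    exact (lintegral_lintegral_swap hH.aemeasurable).le
  have hq0 : 0 < q := by linarith
  set R := ∫⁻ y, (∫⁻ x, H x y ^ q ∂μ) ^ (1 / q) ∂ν with hR
  have hconj : q.conjExponent.HolderConjugate q := (Real.HolderConjugate.conjExponent hq1).symm
  rw [one_div, ENNReal.rpow_inv_le_iff hq0]
  -- Duality, run on a simple `g` of finite integral below the `q`-th power of the inner integral,
  -- so that a power of `∫ g` can be cancelled at the end without assuming the left side finite.
  refine le_of_forall_lt fun c hc => ?_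
  rw [lintegral_eq_nnreal] at hc
  simp_rw [lt_iSup_iff] at hc
  obtain ⟨g₀, hg₀, hcg₀⟩ := hc
  rw [← SimpleFunc.lintegral_eq_lintegral] at hcg₀
  obtain ⟨g, hgg₀, hgfin, hcg⟩ := SimpleFunc.exists_lt_lintegral_simpleFunc_of_lt_lintegral
    (f := g₀) hcg₀
  have hgJ : ∀ x, (g x : ℝ≥0∞) ≤ (∫⁻ y, H x y ∂ν) ^ q := fun x =>
    (ENNReal.coe_le_coe.2 (hgg₀ x)).trans (hg₀ x)
  refine hcg.trans_le ?_
  set A := ∫⁻ x, (g x : ℝ≥0∞) ∂μ with hA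
  have hgm : Measurable fun x => (g x : ℝ≥0∞) := g.measurable.coe_nnreal_ennreal
  have hHx : ∀ x, Measurable fun y => H x y := fun x => hH.comp measurable_prodMk_left
  have hHy : ∀ y, Measurable fun x => H x y := fun y => hH.comp measurable_prodMk_right
  -- Split `g = g^{1/q'} g^{1/q}`, bound the second factor by the inner integral, swap the
  -- integrals, and apply Hölder in `x` for each `y`.
  have key : A ≤ A ^ (1 / q.conjExponent) * R := by
    calc A ≤ ∫⁻ x, (g x : ℝ≥0∞) ^ (1 / q.conjExponent) * ∫⁻ y, H x y ∂ν ∂μ := by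
          refine lintegral_mono fun x => ?_
          have h1 : (g x : ℝ≥0∞) ^ (1 / q) ≤ ∫⁻ y, H x y ∂ν := by
            rw [one_div, ENNReal.rpow_inv_le_iff hq0]; exact hgJ x
          calc (g x : ℝ≥0∞) = (g x : ℝ≥0∞) ^ (1 / q.conjExponent) * (g x : ℝ≥0∞) ^ (1 / q) := by
                rw [← ENNReal.rpow_add_of_nonneg _ _ hconj.one_div_nonneg
                  hconj.symm.one_div_nonneg, one_div, one_div, hconj.inv_add_inv_eq_one,
                  ENNReal.rpow_one]
            _ ≤ _ := by gcongr
      _ = ∫⁻ x, ∫⁻ y, (g x : ℝ≥0∞) ^ (1 / q.conjExponent) * H x y ∂ν ∂μ := by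
          refine lintegral_congr fun x => ?_
          rw [lintegral_const_mul _ (hHx x)]
      _ = ∫⁻ y, ∫⁻ x, (g x : ℝ≥0∞) ^ (1 / q.conjExponent) * H x y ∂μ ∂ν := by
          refine lintegral_lintegral_swap (Measurable.aemeasurable ?_)
          exact ((hgm.comp measurable_fst).pow_const _).mul hH
      _ ≤ ∫⁻ y, A ^ (1 / q.conjExponent) * (∫⁻ x, H x y ^ q ∂μ) ^ (1 / q) ∂ν := by
          refine lintegral_mono fun y => ?_
          refine (ENNReal.lintegral_mul_le_Lp_mul_Lq μ hconj (hgm.pow_const _).aemeasurable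
            (hHy y).aemeasurable).trans_eq ?_
          congr 2
          refine lintegral_congr fun x => ?_
          rw [one_div, ENNReal.rpow_inv_rpow hconj.ne_zero]
      _ = _ := by
          rw [lintegral_const_mul]
          exact (hH.pow_const q).lintegral_prod_left'.pow_const _
  rcases eq_or_ne A 0 with h0 | h0
  · rw [h0]; exact zero_le
  have hAt : A ≠ ⊤ := hgfin.ne
  have hA0 : A ^ (1 / q.conjExponent) ≠ 0 := by
    simp [ENNReal.rpow_eq_zero_iff, h0, hAt]
  have hAt' : A ^ (1 / q.conjExponent) ≠ ⊤ :=
    ENNReal.rpow_ne_top_of_nonneg hconj.one_div_nonneg hAt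
  rw [← ENNReal.rpow_inv_le_iff hq0]
  have hsplit : A = A ^ (1 / q.conjExponent) * A ^ q⁻¹ := by
    rw [← ENNReal.rpow_add_of_nonneg _ _ hconj.one_div_nonneg hconj.symm.inv_nonneg, one_div,
      hconj.inv_add_inv_eq_one, ENNReal.rpow_one]
  rw [hsplit] at key
  nth_rewrite 2 [← hsplit] at key
  exact (ENNReal.mul_le_mul_iff_right hA0 hAt').mp key

/-- A sum of powers `2^{kβ}`, `β ≠ 0`, over a set of integers is comparable to its largest term. -/
theorem exists_tsum_indicator_two_rpow_le {β : ℝ} (hβ : β ≠ 0) :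
    ∃ C : ℝ≥0, ∀ A : Set ℤ,
      ∑' k : ℤ, A.indicator (fun k : ℤ => ENNReal.ofReal ((2 : ℝ) ^ ((k : ℝ) * β))) k ≤
        C * ⨆ k ∈ A, ENNReal.ofReal ((2 : ℝ) ^ ((k : ℝ) * β)) := by
  have hnat : Summable fun n : ℕ => (2 : ℝ) ^ (-|β| * (n : ℝ)) := by
    have : ∀ n : ℕ, (2 : ℝ) ^ (-|β| * (n : ℝ)) = ((2 : ℝ) ^ (-|β|)) ^ n := fun n => by
      rw [Real.rpow_mul (by norm_num), Real.rpow_natCast]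
    simp_rw [this]
    exact summable_geometric_of_lt_one (by positivity)
      (Real.rpow_lt_one_of_one_lt_of_neg one_lt_two (by simpa using hβ))
  have hint : Summable fun j : ℤ => (2 : ℝ) ^ (-|β| * |(j : ℝ)|) :=
    Summable.of_nat_of_neg (by simpa using hnat) (by simpa using hnat)
  have hne : ∑' j : ℤ, ENNReal.ofReal ((2 : ℝ) ^ (-|β| * |(j : ℝ)|)) ≠ ⊤ := by
    rw [← ENNReal.ofReal_tsum_of_nonneg (fun j => by positivity) hint]
    exact ENNReal.ofReal_ne_top
  refine ⟨(∑' j : ℤ, ENNReal.ofReal ((2 : ℝ) ^ (-|β| * |(j : ℝ)|))).toNNReal, fun A => ?_⟩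
  rw [ENNReal.coe_toNNReal hne]
  classical
  refine ENNReal.summable.tsum_le_of_sum_le fun s => ?_
  have hs : ∑ k ∈ s, A.indicator (fun k : ℤ => ENNReal.ofReal ((2 : ℝ) ^ ((k : ℝ) * β))) k =
      ∑ k ∈ s with k ∈ A, ENNReal.ofReal ((2 : ℝ) ^ ((k : ℝ) * β)) := by
    rw [Finset.sum_filter]
    rfl
  rw [hs]
  rcases (s.filter (· ∈ A)).eq_empty_or_nonempty with he | hne'
  · rw [he]; simp
  -- The supremum over `A` need not be attained, hence the finite partial sums. Relative to the
  -- maximal term, the term at `k` is smaller by exactly `2^{-|β||k-m|}`, which is summable over all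
  -- integers.
  obtain ⟨m, hm, hmax⟩ := Finset.exists_max_image _ (fun k : ℤ => (k : ℝ) * β) hne'
  have hmA : m ∈ A := (Finset.mem_filter.mp hm).2
  calc ∑ k ∈ s with k ∈ A, ENNReal.ofReal ((2 : ℝ) ^ ((k : ℝ) * β))
      ≤ ∑ k ∈ s with k ∈ A, ENNReal.ofReal ((2 : ℝ) ^ (-|β| * |((k - m : ℤ) : ℝ)|)) *
          ENNReal.ofReal ((2 : ℝ) ^ ((m : ℝ) * β)) := by
        refine Finset.sum_le_sum fun k hk => ?_
        rw [← ENNReal.ofReal_mul (by positivity), ← Real.rpow_add (by norm_num)]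
        refine ENNReal.ofReal_le_ofReal (Real.rpow_le_rpow_of_exponent_le (by norm_num) ?_)
        have h1 := hmax k hk
        have h2 : |β| * |((k - m : ℤ) : ℝ)| = (m - k) * β := by
          rw [← abs_mul]
          push_cast
          rw [abs_of_nonpos (by linarith)]
          ring
        linarith
    _ = (∑ k ∈ s with k ∈ A, ENNReal.ofReal ((2 : ℝ) ^ (-|β| * |((k - m : ℤ) : ℝ)|))) *
          ENNReal.ofReal ((2 : ℝ) ^ ((m : ℝ) * β)) := by rw [Finset.sum_mul]
    _ ≤ _ := by
        gcongr
        · refine (ENNReal.sum_le_tsum _).trans_eq ?_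
          exact (Equiv.subRight m).tsum_eq
            (fun j : ℤ => ENNReal.ofReal ((2 : ℝ) ^ (-|β| * |(j : ℝ)|)))
        · exact le_iSup₂ (f := fun (k : ℤ) (_ : k ∈ A) =>
            ENNReal.ofReal ((2 : ℝ) ^ ((k : ℝ) * β))) m hmA

/-! ### Continuity, hence measurability, of the localizations -/

/-- Translations act continuously on the Schwartz space. -/
theorem continuous_compSubConstCLM {E : Type*} [NormedAddCommGroup E] [NormedSpace ℝ E]
    (f : 𝓢(E, ℂ)) : Continuous fun a : E => f.compSubConstCLM ℂ a := by
  rw [continuous_iff_continuousAt]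
  intro a
  rw [ContinuousAt, (schwartz_withSeminorms ℂ E ℂ).tendsto_nhds _ _]
  rintro ⟨m, n⟩ ε hε
  set S : ℝ := SchwartzMap.seminorm ℂ m (n + 1) f
  set S0 : ℝ := SchwartzMap.seminorm ℂ 0 (n + 1) f
  -- `M` bounds `‖y‖^m ‖D^{n+1} f‖` on the segment from `y - a` to `y - b`, uniformly in `y` and in
  -- `b` within distance 1 of `a`, since `‖y‖ ≤ ‖z‖ + ‖a‖ + 1` there. The mean value inequality then
  -- bounds the seminorm by `M ‖b - a‖`.
  set M : ℝ := 2 ^ m * (S + (‖a‖ + 1) ^ m * S0) with hM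
  have hS : 0 ≤ S := apply_nonneg _ _
  have hS0 : 0 ≤ S0 := apply_nonneg _ _
  have hM0 : 0 ≤ M := by positivity
  have hev : ∀ᶠ b in nhds a, M * ‖b - a‖ < ε := by
    have : Filter.Tendsto (fun b => M * ‖b - a‖) (nhds a) (nhds (M * ‖a - a‖)) := by
      apply Continuous.tendsto; fun_prop
    rw [sub_self, norm_zero, mul_zero] at this
    exact this.eventually (gt_mem_nhds hε)
  filter_upwards [hev, Metric.ball_mem_nhds a one_pos] with b hb hb1
  refine lt_of_le_of_lt ?_ hb
  refine SchwartzMap.seminorm_le_bound ℂ m n _ (by positivity) fun y => ?_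
  have hsub : iteratedFDeriv ℝ n (f.compSubConstCLM ℂ b - f.compSubConstCLM ℂ a : 𝓢(E, ℂ)) y =
      iteratedFDeriv ℝ n f (y - b) - iteratedFDeriv ℝ n f (y - a) := by
    rw [show ((f.compSubConstCLM ℂ b - f.compSubConstCLM ℂ a : 𝓢(E, ℂ)) : E → ℂ) =
        (f.compSubConstCLM ℂ b : E → ℂ) - (f.compSubConstCLM ℂ a : E → ℂ) from rfl,
      iteratedFDeriv_sub_apply ((f.compSubConstCLM ℂ b).smooth n).contDiffAt
        ((f.compSubConstCLM ℂ a).smooth n).contDiffAt]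
    congr 1
    · exact congrFun (iteratedFDeriv_comp_sub' (𝕜 := ℝ) (f := f) n b) y
    · exact congrFun (iteratedFDeriv_comp_sub' (𝕜 := ℝ) (f := f) n a) y
  rw [hsub]
  have hbound : ∀ z ∈ segment ℝ (y - a) (y - b),
      ‖fderiv ℝ (iteratedFDeriv ℝ n f) z‖ * ‖y‖ ^ m ≤ M := by
    intro z hz
    have hzy : ‖y‖ ≤ ‖z‖ + (‖a‖ + 1) := by
      have hz' : z ∈ Metric.closedBall (y - a) 1 := by
        refine (convex_closedBall (y - a) 1).segment_subset (by simp) ?_ hz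
        rw [Metric.mem_closedBall, dist_eq_norm]
        rw [Metric.mem_ball, dist_eq_norm] at hb1
        rw [show y - b - (y - a) = -(b - a) by abel, norm_neg]
        exact hb1.le
      rw [Metric.mem_closedBall, dist_eq_norm] at hz'
      have : y = z - (z - (y - a)) + a := by abel
      calc ‖y‖ = ‖z - (z - (y - a)) + a‖ := by rw [← this]
        _ ≤ ‖z‖ + ‖z - (y - a)‖ + ‖a‖ := (norm_add_le _ _).trans (by gcongr; exact norm_sub_le _ _)
        _ ≤ _ := by linarith
    rw [norm_fderiv_iteratedFDeriv]
    have h1 : ‖z‖ ^ m * ‖iteratedFDeriv ℝ (n + 1) f z‖ ≤ S := SchwartzMap.le_seminorm ℂ _ _ f z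
    have h2 : ‖iteratedFDeriv ℝ (n + 1) f z‖ ≤ S0 :=
      SchwartzMap.norm_iteratedFDeriv_le_seminorm ℂ f _ z
    have h3 : ‖y‖ ^ m ≤ 2 ^ m * (‖z‖ ^ m + (‖a‖ + 1) ^ m) := by
      calc ‖y‖ ^ m ≤ (‖z‖ + (‖a‖ + 1)) ^ m := by gcongr
        _ ≤ 2 ^ (m - 1) * (‖z‖ ^ m + (‖a‖ + 1) ^ m) :=
            add_pow_le (norm_nonneg _) (by positivity) m
        _ ≤ _ := by
            gcongr
            · norm_num
            · omega
    calc ‖iteratedFDeriv ℝ (n + 1) f z‖ * ‖y‖ ^ m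
        ≤ ‖iteratedFDeriv ℝ (n + 1) f z‖ * (2 ^ m * (‖z‖ ^ m + (‖a‖ + 1) ^ m)) := by gcongr
      _ = 2 ^ m * (‖z‖ ^ m * ‖iteratedFDeriv ℝ (n + 1) f z‖ +
            (‖a‖ + 1) ^ m * ‖iteratedFDeriv ℝ (n + 1) f z‖) := by ring
      _ ≤ M := by rw [hM]; gcongr
  have hdiff : Differentiable ℝ (iteratedFDeriv ℝ n f) :=
    (f.smooth (n + 1 : ℕ)).differentiable_iteratedFDeriv (by exact_mod_cast Nat.lt_succ_self n)
  have hmv := Convex.norm_image_sub_le_of_norm_fderiv_le (𝕜 := ℝ)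
    (f := fun z => ‖y‖ ^ m • iteratedFDeriv ℝ n f z) (C := M) (s := segment ℝ (y - a) (y - b))
    (fun z _ => (hdiff z).fun_const_smul _) (fun z hz => by
      rw [fderiv_fun_const_smul (hdiff z), norm_smul, norm_pow, norm_norm, mul_comm]
      exact hbound z hz) (convex_segment _ _) (left_mem_segment ℝ _ _) (right_mem_segment ℝ _ _)
  rw [← smul_sub, norm_smul, norm_pow, norm_norm,
    show y - b - (y - a) = -(b - a) by abel, norm_neg] at hmv
  exact hmv

/-- The kernel at `x` is the translate by `x` of the kernel at `0`. -/
theorem LPBump.continuous_kernel {d : ℕ} (φ : LPBump d) (k : ℤ) : Continuous (φ.kernel k) := by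
  rw [continuous_induced_rng]
  have h : (Subtype.val ∘ φ.kernel k) = fun x : EuclideanSpace ℝ (Fin d) =>
      ((φ.kernel k 0 : 𝓢(EuclideanSpace ℝ (Fin d), ℂ))).compSubConstCLM ℂ x := by
    funext x
    ext y
    rw [Function.comp_apply, SchwartzMap.compSubConstCLM_apply, LPBump.kernel_apply,
      LPBump.kernel_apply, zero_sub, neg_sub]
  rw [h]
  exact continuous_compSubConstCLM _

theorem LPBump.continuous_L {d : ℕ} (φ : LPBump d) (f : SInftyDual d) (k : ℤ) : Continuous (φ.L f k) :=
  f.continuous.comp (φ.continuous_kernel k)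

/-! ### Lorentz quasi-norms as integrals against a power measure -/

/-- The measure `r lam^{r-1} dlam` on `(0, ∞)`. -/
def powMeasure (r : ℝ) : Measure ℝ :=
  (volume.restrict (Set.Ioi 0)).withDensity fun lam => ENNReal.ofReal (r * lam ^ (r - 1))

theorem measurable_powMeasure_density (r : ℝ) :
    Measurable fun lam : ℝ => ENNReal.ofReal (r * lam ^ (r - 1)) := by
  fun_prop

instance (r : ℝ) : SigmaFinite (powMeasure r) :=
  SigmaFinite.withDensity_of_ne_top (by simp)

theorem lintegral_powMeasure (r : ℝ) (f : ℝ → ℝ≥0∞) :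
    ∫⁻ lam, f lam ∂powMeasure r =
      ∫⁻ lam in Set.Ioi 0, ENNReal.ofReal (r * lam ^ (r - 1)) * f lam := by
  rw [powMeasure, lintegral_withDensity_eq_lintegral_mul_non_measurable _
    (measurable_powMeasure_density r) (by simp)]
  rfl

/-- The factor `r` in the density is what makes this exact; it is the layer-cake formula for one
indicator. -/
theorem powMeasure_Iio {r t : ℝ} (hr : 0 < r) (ht : 0 ≤ t) :
    powMeasure r (Set.Iio t) = ENNReal.ofReal (t ^ r) := by
  have hint : IntervalIntegrable (fun lam : ℝ => r * lam ^ (r - 1)) volume 0 t :=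
    (intervalIntegral.intervalIntegrable_rpow' (by linarith)).const_mul r
  rw [powMeasure, withDensity_apply _ measurableSet_Iio, Measure.restrict_restrict measurableSet_Iio,
    Set.inter_comm, Set.Ioi_inter_Iio, restrict_Ioo_eq_restrict_Ioc,
    ← ofReal_integral_eq_lintegral_ofReal ((intervalIntegrable_iff_integrableOn_Ioc_of_le ht).mp hint),
    ← intervalIntegral.integral_of_le ht, intervalIntegral.integral_const_mul,
    integral_rpow (Or.inl (by linarith))]
  · congr 1
    rw [sub_add_cancel, Real.zero_rpow hr.ne']
    field_simp
    ring
  · filter_upwards [ae_restrict_mem measurableSet_Ioc] with lam hlam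
    have := hlam.1
    positivity

/-- Substitution `lam = c u` in a density homogeneous of degree `r - 1`. It yields the homogeneity
of the Lorentz quasi-norm. -/
theorem lintegral_powMeasure_comp_div {r c : ℝ} (hc : 0 < c) (f : ℝ → ℝ≥0∞) :
    ∫⁻ lam, f (lam / c) ∂powMeasure r = ENNReal.ofReal (c ^ r) * ∫⁻ lam, f lam ∂powMeasure r := by
  rw [lintegral_powMeasure, lintegral_powMeasure]
  have himg : (fun lam : ℝ => c * lam) '' Set.Ioi 0 = Set.Ioi 0 := by
    rw [Set.image_mul_left_Ioi hc, mul_zero]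
  conv_lhs => rw [← himg]
  rw [lintegral_image_eq_lintegral_abs_deriv_mul (f' := fun _ => c) measurableSet_Ioi
    (fun x _ => by simpa using ((hasDerivAt_id x).const_mul c).hasDerivWithinAt)
    (mul_right_injective₀ hc.ne').injOn, ← lintegral_const_mul' _ _ ENNReal.ofReal_ne_top]
  refine setLIntegral_congr_fun measurableSet_Ioi fun lam hlam => ?_
  have hlam : 0 < lam := hlam
  rw [mul_div_cancel_left₀ _ hc.ne', ← mul_assoc, ← mul_assoc,
    ← ENNReal.ofReal_mul (abs_nonneg _), ← ENNReal.ofReal_mul (by positivity)]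
  congr 2
  rw [abs_of_pos hc, Real.mul_rpow hc.le hlam.le, Real.rpow_sub_one hc.ne']
  field_simp

theorem le_lqNorm {q : ℝ≥0∞} (hq : q ≠ 0) (a : ℤ → ℝ≥0∞) (k : ℤ) : a k ≤ lqNorm q a := by
  unfold lqNorm
  split_ifs with h
  · exact le_iSup a k
  · rw [one_div, ENNReal.le_rpow_inv_iff (ENNReal.toReal_pos hq h)]
    exact ENNReal.le_tsum k

section Lorentz

variable {α : Type*} [MeasurableSpace α]

theorem measurable_distribFn (g : α → ℂ) (μ : Measure α) : Measurable (distribFn g μ) := by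
  refine Antitone.measurable fun a b hab => measure_mono fun x hx => ?_
  exact lt_of_le_of_lt hab hx

theorem lorentzQNorm_top (g : α → ℂ) (p : ℝ) (μ : Measure α) :
    lorentzQNorm g p ⊤ μ =
      ⨆ lam ∈ Set.Ioi (0 : ℝ), ENNReal.ofReal lam * distribFn g μ lam ^ (1 / p) :=
  if_pos rfl

theorem lorentzQNorm_of_ne_top (g : α → ℂ) (p : ℝ) {r : ℝ≥0∞} (hr : r ≠ ⊤)
    (μ : Measure α) :
    lorentzQNorm g p r μ =
      (∫⁻ lam, distribFn g μ lam ^ (r.toReal / p) ∂powMeasure r.toReal) ^ (1 / r.toReal) := by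
  rw [lorentzQNorm, if_neg hr, lintegral_powMeasure, ← lintegral_const_mul' _ _ hr]
  congr 1
  refine setLIntegral_congr_fun measurableSet_Ioi fun lam hlam => ?_
  have hlam : 0 < lam := hlam
  nth_rewrite 1 [← ENNReal.ofReal_toReal hr]
  rw [mul_right_comm, ← mul_assoc, ← ENNReal.ofReal_mul (by positivity),
    ← ENNReal.ofReal_mul (by positivity), Real.rpow_sub_one hlam.ne']
  congr 2
  ring

theorem lorentzQNorm_rpow_toReal (g : α → ℂ) (p : ℝ) {r : ℝ≥0∞} (hr0 : r ≠ 0) (hr : r ≠ ⊤)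
    (μ : Measure α) :
    lorentzQNorm g p r μ ^ r.toReal =
      ∫⁻ lam, distribFn g μ lam ^ (r.toReal / p) ∂powMeasure r.toReal := by
  rw [lorentzQNorm_of_ne_top g p hr, one_div,
    ENNReal.rpow_inv_rpow (ENNReal.toReal_pos hr0 hr).ne']

theorem distribFn_const_mul (g : α → ℂ) (μ : Measure α) {c : ℝ} (hc : 0 < c) (lam : ℝ) :
    distribFn (fun x => (c : ℂ) * g x) μ lam = distribFn g μ (lam / c) := by
  unfold distribFn
  congr 1
  ext x
  simp only [Set.mem_ofPred_eq, norm_mul, Complex.norm_real, Real.norm_eq_abs, abs_of_pos hc]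
  rw [div_lt_iff₀' hc]

theorem lorentzQNorm_const_mul (g : α → ℂ) (p : ℝ) {r : ℝ≥0∞} (hr0 : r ≠ 0) (μ : Measure α)
    {c : ℝ} (hc : 0 < c) :
    lorentzQNorm (fun x => (c : ℂ) * g x) p r μ = ENNReal.ofReal c * lorentzQNorm g p r μ := by
  rcases eq_or_ne r ⊤ with rfl | hr
  · rw [lorentzQNorm_top, lorentzQNorm_top]
    simp_rw [distribFn_const_mul g μ hc, ENNReal.mul_iSup]
    apply le_antisymm
    · refine iSup₂_le fun lam hlam => ?_
      refine le_trans ?_ (le_iSup₂ (f := fun (lam : ℝ) (_ : lam ∈ Set.Ioi (0 : ℝ)) =>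
        ENNReal.ofReal c * (ENNReal.ofReal lam * distribFn g μ lam ^ (1 / p))) (lam / c)
        (div_pos hlam hc))
      rw [← mul_assoc, ← ENNReal.ofReal_mul hc.le, mul_div_cancel₀ _ hc.ne']
    · refine iSup₂_le fun lam hlam => ?_
      refine le_trans ?_ (le_iSup₂ (f := fun (lam : ℝ) (_ : lam ∈ Set.Ioi (0 : ℝ)) =>
        ENNReal.ofReal lam * distribFn g μ (lam / c) ^ (1 / p)) (c * lam)
        (mul_pos hc hlam))
      rw [← mul_assoc, ← ENNReal.ofReal_mul hc.le, mul_div_cancel_left₀ _ hc.ne']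
  · have hr' := ENNReal.toReal_pos hr0 hr
    rw [lorentzQNorm_of_ne_top _ p hr, lorentzQNorm_of_ne_top _ p hr]
    simp_rw [distribFn_const_mul g μ hc]
    rw [lintegral_powMeasure_comp_div hc (fun lam => distribFn g μ lam ^ (r.toReal / p)),
      ENNReal.mul_rpow_of_nonneg _ _ (by positivity), ENNReal.ofReal_rpow_of_pos (by positivity),
      one_div, Real.rpow_rpow_inv hc.le hr'.ne']

end Lorentz

/-! ### Level sums and the distribution function for `μ_γ` -/

/-- The sum of `2^{kβ}` over the `k` with `lam < T k`. -/
def levelSum (β : ℝ) (T : ℤ → ℝ) (lam : ℝ) : ℝ≥0∞ :=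
  ∑' k : ℤ, {k | lam < T k}.indicator (fun k : ℤ => ENNReal.ofReal ((2 : ℝ) ^ ((k : ℝ) * β))) k

theorem le_levelSum {β lam : ℝ} {T : ℤ → ℝ} {k : ℤ} (hk : lam < T k) :
    ENNReal.ofReal ((2 : ℝ) ^ ((k : ℝ) * β)) ≤ levelSum β T lam := by
  refine le_trans ?_ (ENNReal.le_tsum k)
  rw [Set.indicator_of_mem (by exact hk)]

theorem ofReal_two_rpow_mul (k : ℤ) (β t : ℝ) :
    ENNReal.ofReal ((2 : ℝ) ^ ((k : ℝ) * (β * t))) =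
      ENNReal.ofReal ((2 : ℝ) ^ ((k : ℝ) * β)) ^ t := by
  rw [ENNReal.ofReal_rpow_of_pos (by positivity), ← Real.rpow_mul (by norm_num), mul_assoc]

/-- Replace the geometric sum by its largest term, whose `t`-th power is a term of the sum with
exponent `β * t`. This lemma and its converse let a power pass through the sum over `k`, uniformly
in `T` and `lam`. -/
theorem exists_levelSum_rpow_le {β t : ℝ} (hβ : β ≠ 0) (ht : 0 < t) :
    ∃ C : ℝ≥0, ∀ T lam, levelSum β T lam ^ t ≤ C * levelSum (β * t) T lam := by
  obtain ⟨C, hC⟩ := exists_tsum_indicator_two_rpow_le hβ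
  refine ⟨C ^ t, fun T lam => ?_⟩
  rw [ENNReal.coe_rpow_of_nonneg _ ht.le]
  refine (ENNReal.rpow_le_rpow (hC {k | lam < T k}) ht.le).trans ?_
  rw [ENNReal.mul_rpow_of_nonneg _ _ ht.le]
  gcongr
  rw [← ENNReal.le_rpow_inv_iff ht]
  refine iSup₂_le fun k hk => ?_
  rw [ENNReal.le_rpow_inv_iff ht, ← ofReal_two_rpow_mul]
  exact le_levelSum hk

theorem exists_levelSum_mul_le {β t : ℝ} (hβ : β ≠ 0) (ht : 0 < t) :
    ∃ C : ℝ≥0, ∀ T lam, levelSum (β * t) T lam ≤ C * levelSum β T lam ^ t := by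
  obtain ⟨C, hC⟩ := exists_tsum_indicator_two_rpow_le (mul_ne_zero hβ ht.ne')
  refine ⟨C, fun T lam => (hC {k | lam < T k}).trans ?_⟩
  gcongr
  refine iSup₂_le fun k hk => ?_
  rw [ofReal_two_rpow_mul]
  exact ENNReal.rpow_le_rpow (le_levelSum hk) ht.le

/-- Layer cake in `lam`, one `k` at a time. -/
theorem lintegral_levelSum {β r : ℝ} (hr : 0 < r) {T : ℤ → ℝ} (hT : ∀ k, 0 ≤ T k) :
    ∫⁻ lam, levelSum β T lam ∂powMeasure r =
      ∑' k : ℤ, ENNReal.ofReal ((2 : ℝ) ^ ((k : ℝ) * β)) * ENNReal.ofReal (T k ^ r) := by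
  have h : ∀ (k : ℤ) (lam : ℝ),
      {k | lam < T k}.indicator (fun k : ℤ => ENNReal.ofReal ((2 : ℝ) ^ ((k : ℝ) * β))) k =
        (Set.Iio (T k)).indicator (fun _ => ENNReal.ofReal ((2 : ℝ) ^ ((k : ℝ) * β))) lam :=
    fun _ _ => rfl
  unfold levelSum
  simp_rw [h]
  rw [lintegral_tsum fun k => (measurable_const.indicator measurableSet_Iio).aemeasurable]
  refine tsum_congr fun k => ?_
  rw [lintegral_indicator_const measurableSet_Iio, powMeasure_Iio hr (hT k)]

theorem measurable_levelSum {α : Type*} [MeasurableSpace α] (β : ℝ) {T : α → ℤ → ℝ}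
    (hT : ∀ k, Measurable fun x => T x k) :
    Measurable fun z : α × ℝ => levelSum β (T z.1) z.2 := by
  refine Measurable.tsum fun k => ?_
  have h : (fun z : α × ℝ => {k | z.2 < T z.1 k}.indicator
      (fun k : ℤ => ENNReal.ofReal ((2 : ℝ) ^ ((k : ℝ) * β))) k) =
      {z : α × ℝ | z.2 < T z.1 k}.indicator
        (fun _ => ENNReal.ofReal ((2 : ℝ) ^ ((k : ℝ) * β))) := rfl
  rw [h]
  exact measurable_const.indicator
    (measurableSet_lt measurable_snd ((hT k).comp measurable_fst))

variable {d : ℕ}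

theorem distribFn_muGamma {h : EuclideanSpace ℝ (Fin d) × ℤ → ℂ} (hh : Measurable h)
    (γ lam : ℝ) :
    distribFn h (muGamma d γ) lam = ∑' k : ℤ, ENNReal.ofReal ((2 : ℝ) ^ ((k : ℝ) * (-γ))) *
      distribFn (fun x => h (x, k)) volume lam := by
  have hs : MeasurableSet {z | lam < ‖h z‖} := measurableSet_lt measurable_const hh.norm
  rw [distribFn, muGamma, Measure.sum_apply _ hs]
  refine tsum_congr fun k => ?_
  rw [Measure.smul_apply, Measure.map_apply measurable_prodMk_right hs, smul_eq_mul, distribFn]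
  rw [neg_mul_comm]
  rfl

/-- Tonelli: summing over `k` before integrating in `x` exposes the level sum at each point. -/
theorem distribFn_muGamma_eq_lintegral {h : EuclideanSpace ℝ (Fin d) × ℤ → ℂ} (hh : Measurable h)
    (γ lam : ℝ) :
    distribFn h (muGamma d γ) lam = ∫⁻ x, levelSum (-γ) (fun k => ‖h (x, k)‖) lam := by
  have hk : ∀ k, MeasurableSet {x | lam < ‖h (x, k)‖} := fun k =>
    measurableSet_lt measurable_const (hh.comp measurable_prodMk_right).norm
  have hind : ∀ (k : ℤ) (x : EuclideanSpace ℝ (Fin d)), {k | lam < ‖h (x, k)‖}.indicator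
      (fun k : ℤ => ENNReal.ofReal ((2 : ℝ) ^ ((k : ℝ) * (-γ)))) k =
      {x | lam < ‖h (x, k)‖}.indicator (fun _ => ENNReal.ofReal ((2 : ℝ) ^ ((k : ℝ) * (-γ)))) x :=
    fun _ _ => rfl
  rw [distribFn_muGamma hh]
  unfold levelSum
  simp_rw [hind]
  rw [lintegral_tsum fun k => (measurable_const.indicator (hk k)).aemeasurable]
  refine tsum_congr fun k => ?_
  rw [lintegral_indicator_const (hk k), distribFn]

/-! ### Comparison of the quasi-norms -/

namespace LPBump

variable (φ : LPBump d)

theorem measurable_P (b : ℝ) (f : SInftyDual d) : Measurable (φ.P b f) := by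
  refine measurable_from_prod_countable_left fun k => ?_
  exact (φ.continuous_L f k).measurable.const_mul (((2 : ℝ) ^ ((k : ℝ) * b) : ℝ) : ℂ)

theorem two_rpow_mul_two_rpow {p : ℝ} (s γ : ℝ) (k : ℤ) :
    ENNReal.ofReal ((2 : ℝ) ^ ((k : ℝ) * (-γ))) ^ (1 / p) *
      ENNReal.ofReal ((2 : ℝ) ^ ((k : ℝ) * (s + γ / p))) =
      ENNReal.ofReal ((2 : ℝ) ^ ((k : ℝ) * s)) := by
  rw [← ofReal_two_rpow_mul, ← ENNReal.ofReal_mul (by positivity), ← Real.rpow_add (by norm_num)]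
  congr 2
  ring

theorem rpow_mul_lorentzQNorm_P {p : ℝ} (s γ : ℝ) {r : ℝ≥0∞} (hr0 : r ≠ 0) (f : SInftyDual d)
    (k : ℤ) :
    ENNReal.ofReal ((2 : ℝ) ^ ((k : ℝ) * (-γ))) ^ (1 / p) *
      lorentzQNorm (fun x => φ.P (s + γ / p) f (x, k)) p r volume =
      ENNReal.ofReal ((2 : ℝ) ^ ((k : ℝ) * s)) * lorentzQNorm (φ.L f k) p r volume := by
  rw [← two_rpow_mul_two_rpow (p := p) s γ k, mul_assoc]
  congr 1
  exact lorentzQNorm_const_mul (φ.L f k) p hr0 volume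
    (c := (2 : ℝ) ^ ((k : ℝ) * (s + γ / p))) (by positivity)

theorem rpow_mul_enorm_P {p : ℝ} (s γ : ℝ) (f : SInftyDual d) (k : ℤ)
    (x : EuclideanSpace ℝ (Fin d)) :
    ENNReal.ofReal ((2 : ℝ) ^ ((k : ℝ) * (-γ))) ^ (1 / p) * ‖φ.P (s + γ / p) f (x, k)‖ₑ =
      ENNReal.ofReal ((2 : ℝ) ^ ((k : ℝ) * s)) * ‖φ.L f k x‖ₑ := by
  rw [← two_rpow_mul_two_rpow (p := p) s γ k, mul_assoc]
  congr 1
  rw [P, enorm_mul, ← ofReal_norm, Complex.norm_real, Real.norm_of_nonneg (by positivity)]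

/-- Each term of the Besov quasi-norm in terms of `P^{s+γ/p} f`. -/
theorem besov_term_rpow {p : ℝ} (hp : 0 < p) (s γ : ℝ) {r : ℝ≥0∞} (hr0 : r ≠ 0) (hr : r ≠ ⊤)
    (f : SInftyDual d) (k : ℤ) :
    (ENNReal.ofReal ((2 : ℝ) ^ ((k : ℝ) * s)) * lorentzQNorm (φ.L f k) p r volume) ^ r.toReal =
      ∫⁻ lam, (ENNReal.ofReal ((2 : ℝ) ^ ((k : ℝ) * (-γ))) *
        distribFn (fun x => φ.P (s + γ / p) f (x, k)) volume lam) ^ (r.toReal / p)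
          ∂powMeasure r.toReal := by
  rw [← φ.rpow_mul_lorentzQNorm_P s γ hr0 f k, ENNReal.mul_rpow_of_nonneg _ _ ENNReal.toReal_nonneg,
    lorentzQNorm_rpow_toReal _ p hr0 hr, ← ENNReal.rpow_mul, one_div_mul_eq_div,
    ← lintegral_const_mul _ ((measurable_distribFn _ _).pow_const _)]
  refine lintegral_congr fun lam => ?_
  rw [ENNReal.mul_rpow_of_nonneg _ _ (by positivity)]

/-- The outer exponent equals the second Lorentz index, so the sum over `k` moves inside the
`lam`-integral. -/
theorem besovQNorm_rpow {p : ℝ} (hp : 0 < p) (s γ : ℝ) {r : ℝ≥0∞} (hr0 : r ≠ 0) (hr : r ≠ ⊤)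
    (f : SInftyDual d) :
    φ.besovQNorm s r p r f ^ r.toReal =
      ∫⁻ lam, ∑' k : ℤ, (ENNReal.ofReal ((2 : ℝ) ^ ((k : ℝ) * (-γ))) *
        distribFn (fun x => φ.P (s + γ / p) f (x, k)) volume lam) ^ (r.toReal / p)
          ∂powMeasure r.toReal := by
  rw [besovQNorm, lqNorm, if_neg hr, one_div,
    ENNReal.rpow_inv_rpow (ENNReal.toReal_pos hr0 hr).ne', lintegral_tsum fun k =>
      (((measurable_distribFn _ _).const_mul _).pow_const _).aemeasurable]
  exact tsum_congr fun k => φ.besov_term_rpow hp s γ hr0 hr f k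

theorem besovQNorm_le_lorentzQNorm_P {p : ℝ} (hp : 0 < p) (s γ : ℝ) {r : ℝ≥0∞}
    (hr : ENNReal.ofReal p ≤ r) (f : SInftyDual d) :
    φ.besovQNorm s r p r f ≤ lorentzQNorm (φ.P (s + γ / p) f) p r (muGamma d γ) := by
  have hr0 : r ≠ 0 := ((ENNReal.ofReal_pos.mpr hp).trans_le hr).ne'
  rcases eq_or_ne r ⊤ with rfl | hrt
  · rw [besovQNorm, lqNorm, if_pos rfl]
    refine iSup_le fun k => ?_
    rw [← φ.rpow_mul_lorentzQNorm_P s γ hr0 f k, lorentzQNorm_top, lorentzQNorm_top]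
    simp_rw [ENNReal.mul_iSup]
    refine iSup₂_mono fun lam _ => ?_
    rw [distribFn_muGamma (φ.measurable_P _ f), mul_left_comm,
      ← ENNReal.mul_rpow_of_nonneg _ _ (by positivity)]
    gcongr
    exact ENNReal.le_tsum k
  · have hr' := ENNReal.toReal_pos hr0 hrt
    have hpr : p ≤ r.toReal := (ENNReal.ofReal_le_iff_le_toReal hrt).mp hr
    rw [← ENNReal.rpow_le_rpow_iff hr', φ.besovQNorm_rpow hp s γ hr0 hrt,
      lorentzQNorm_rpow_toReal _ p hr0 hrt]
    refine lintegral_mono fun lam => ?_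
    rw [distribFn_muGamma (φ.measurable_P _ f)]
    exact tsum_rpow_le_rpow_tsum _ ((one_le_div hp).mpr hpr)

theorem lorentzQNorm_P_le_besovQNorm {p : ℝ} (hp : 0 < p) (s γ : ℝ) {r : ℝ≥0∞} (hr0 : r ≠ 0)
    (hr : r ≤ ENNReal.ofReal p) (f : SInftyDual d) :
    lorentzQNorm (φ.P (s + γ / p) f) p r (muGamma d γ) ≤ φ.besovQNorm s r p r f := by
  have hrt : r ≠ ⊤ := ne_top_of_le_ne_top ENNReal.ofReal_ne_top hr
  have hr' := ENNReal.toReal_pos hr0 hrt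
  have hpr : r.toReal ≤ p := ENNReal.toReal_le_of_le_ofReal hp.le hr
  rw [← ENNReal.rpow_le_rpow_iff hr', φ.besovQNorm_rpow hp s γ hr0 hrt,
    lorentzQNorm_rpow_toReal _ p hr0 hrt]
  refine lintegral_mono fun lam => ?_
  rw [distribFn_muGamma (φ.measurable_P _ f)]
  exact rpow_tsum_le_tsum_rpow _ (by positivity) ((div_le_one hp).mpr hpr)

theorem measurable_tlFun (s : ℝ) (r : ℝ≥0∞) (f : SInftyDual d) : Measurable (φ.tlFun s r f) := by
  have h : ∀ k : ℤ, Measurable fun x => ENNReal.ofReal ((2 : ℝ) ^ ((k : ℝ) * s)) * ‖φ.L f k x‖ₑ :=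
    fun k => (φ.continuous_L f k).measurable.enorm.const_mul _
  unfold tlFun lqNorm
  split_ifs
  · exact Measurable.iSup h
  · exact (Measurable.tsum fun k => (h k).pow_const _).pow_const _

theorem eLpNorm_tlFun {p : ℝ} (hp : 0 < p) (s : ℝ) (r : ℝ≥0∞) (f : SInftyDual d) :
    eLpNorm (φ.tlFun s r f) (ENNReal.ofReal p) volume =
      (∫⁻ x, φ.tlFun s r f x ^ p) ^ (1 / p) := by
  rw [eLpNorm_eq_lintegral_rpow_enorm_toReal (ENNReal.ofReal_pos.mpr hp).ne'
    ENNReal.ofReal_ne_top, ENNReal.toReal_ofReal hp.le]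
  rfl

/-- With exponent `-γ r/p` the layer-cake weights combine with those in `P` to `2^{ksr}`. -/
theorem lintegral_levelSum_P {p : ℝ} (s γ : ℝ) {r : ℝ≥0∞} (hr0 : r ≠ 0) (hr : r ≠ ⊤)
    (f : SInftyDual d) (x : EuclideanSpace ℝ (Fin d)) :
    ∫⁻ lam, levelSum (-γ * (r.toReal / p)) (fun k => ‖φ.P (s + γ / p) f (x, k)‖) lam
      ∂powMeasure r.toReal = φ.tlFun s r f x ^ r.toReal := by
  have hr' := ENNReal.toReal_pos hr0 hr
  rw [lintegral_levelSum hr' fun _ => norm_nonneg _, tlFun, lqNorm, if_neg hr, one_div,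
    ENNReal.rpow_inv_rpow hr'.ne']
  refine tsum_congr fun k => ?_
  rw [← φ.rpow_mul_enorm_P (p := p) s γ f k x, ENNReal.mul_rpow_of_nonneg _ _ hr'.le,
    ← ENNReal.rpow_mul, one_div_mul_eq_div, ofReal_two_rpow_mul,
    ← ENNReal.ofReal_rpow_of_nonneg (norm_nonneg _) hr'.le, ofReal_norm]

theorem measurable_levelSum_P (b β : ℝ) (f : SInftyDual d) :
    Measurable fun z : EuclideanSpace ℝ (Fin d) × ℝ =>
      levelSum β (fun k => ‖φ.P b f (z.1, k)‖) z.2 :=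
  measurable_levelSum β (T := fun x k => ‖φ.P b f (x, k)‖) fun _ =>
    ((φ.measurable_P b f).comp measurable_prodMk_right).norm

theorem exists_lorentzQNorm_P_le_eLpNorm_tlFun {p : ℝ} (hp : 0 < p) (s : ℝ) {γ : ℝ} (hγ : γ ≠ 0)
    {r : ℝ≥0∞} (hr : ENNReal.ofReal p ≤ r) :
    ∃ C : ℝ≥0, ∀ f : SInftyDual d, lorentzQNorm (φ.P (s + γ / p) f) p r (muGamma d γ) ≤
      C * eLpNorm (φ.tlFun s r f) (ENNReal.ofReal p) volume := by
  have hr0 : r ≠ 0 := ((ENNReal.ofReal_pos.mpr hp).trans_le hr).ne'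
  rcases eq_or_ne r ⊤ with rfl | hrt
  · obtain ⟨C, hC⟩ := exists_tsum_indicator_two_rpow_le (neg_ne_zero.mpr hγ)
    refine ⟨C ^ (1 / p), fun f => ?_⟩
    rw [eLpNorm_tlFun φ hp, lorentzQNorm_top, ENNReal.coe_rpow_of_nonneg _ (by positivity),
      ← ENNReal.mul_rpow_of_nonneg _ _ (by positivity)]
    refine iSup₂_le fun lam hlam => ?_
    rw [← ENNReal.rpow_rpow_inv hp.ne' (ENNReal.ofReal lam), ← one_div,
      ← ENNReal.mul_rpow_of_nonneg _ _ (by positivity),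
      distribFn_muGamma_eq_lintegral (φ.measurable_P _ f)]
    refine ENNReal.rpow_le_rpow ?_ (by positivity)
    rw [← lintegral_const_mul' _ _ (by simp [hp.le]), ← lintegral_const_mul' _ _ (by simp)]
    refine lintegral_mono fun x => ?_
    -- After passing to the largest `2^{-kγ}`, only single `k` with `lam < |P(x,k)|` remain, and for
    -- these `lam` may be replaced by `|P(x,k)|`.
    refine (mul_le_mul_right (hC {k | lam < ‖φ.P (s + γ / p) f (x, k)‖}) _).trans ?_
    rw [mul_left_comm]
    gcongr
    simp_rw [ENNReal.mul_iSup]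
    refine iSup₂_le fun k hk => ?_
    have hk' : ENNReal.ofReal lam ≤ ‖φ.P (s + γ / p) f (x, k)‖ₑ := by
      rw [← ofReal_norm]
      exact ENNReal.ofReal_le_ofReal (le_of_lt hk)
    calc ENNReal.ofReal lam ^ p * ENNReal.ofReal ((2 : ℝ) ^ ((k : ℝ) * (-γ)))
        = (ENNReal.ofReal ((2 : ℝ) ^ ((k : ℝ) * (-γ))) ^ (1 / p) * ENNReal.ofReal lam) ^ p := by
          rw [ENNReal.mul_rpow_of_nonneg _ _ hp.le, one_div, ENNReal.rpow_inv_rpow hp.ne', mul_comm]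
      _ ≤ (ENNReal.ofReal ((2 : ℝ) ^ ((k : ℝ) * s)) * ‖φ.L f k x‖ₑ) ^ p := by
          rw [← φ.rpow_mul_enorm_P (p := p) s γ f k x]
          gcongr
      _ ≤ φ.tlFun s ⊤ f x ^ p := by
          gcongr
          rw [tlFun, lqNorm, if_pos rfl]
          exact le_iSup (fun k : ℤ => ENNReal.ofReal ((2 : ℝ) ^ ((k : ℝ) * s)) * ‖φ.L f k x‖ₑ) k
  · have hr' := ENNReal.toReal_pos hr0 hrt
    have hpr : p ≤ r.toReal := (ENNReal.ofReal_le_iff_le_toReal hrt).mp hr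
    set t := r.toReal / p with ht
    have ht1 : 1 ≤ t := (one_le_div hp).mpr hpr
    have ht0 : 0 < t := by linarith
    obtain ⟨C, hC⟩ := exists_levelSum_rpow_le (neg_ne_zero.mpr hγ) ht0
    -- The `p`-th power of this constant is `C^{1/t}`, the factor left after taking the `1/t`-th
    -- power of the level-sum bound.
    refine ⟨C ^ (1 / r.toReal), fun f => ?_⟩
    rw [eLpNorm_tlFun φ hp, ← ENNReal.rpow_le_rpow_iff hp, lorentzQNorm_of_ne_top _ p hrt]
    have hexp : 1 / r.toReal * p = 1 / t := by rw [ht]; field_simp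
    have hexp' : r.toReal * (1 / t) = p := by rw [ht]; field_simp
    have hG : ∀ x, φ.tlFun s r f x ^ p = (φ.tlFun s r f x ^ r.toReal) ^ (1 / t) := fun x => by
      rw [← ENNReal.rpow_mul, hexp']
    have hmeas : Measurable fun z : ℝ × EuclideanSpace ℝ (Fin d) =>
        levelSum (-γ) (fun k => ‖φ.P (s + γ / p) f (z.2, k)‖) z.1 :=
      (φ.measurable_levelSum_P (s + γ / p) (-γ) f).comp measurable_swap
    calc ((∫⁻ lam, distribFn (φ.P (s + γ / p) f) (muGamma d γ) lam ^ t
          ∂powMeasure r.toReal) ^ (1 / r.toReal)) ^ p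
        = (∫⁻ lam, (∫⁻ x, levelSum (-γ) (fun k => ‖φ.P (s + γ / p) f (x, k)‖) lam) ^ t
          ∂powMeasure r.toReal) ^ (1 / t) := by
          rw [← ENNReal.rpow_mul, hexp]
          simp_rw [distribFn_muGamma_eq_lintegral (φ.measurable_P _ f)]
      _ ≤ ∫⁻ x, (∫⁻ lam, levelSum (-γ) (fun k => ‖φ.P (s + γ / p) f (x, k)‖) lam ^ t
          ∂powMeasure r.toReal) ^ (1 / t) :=
          lintegral_rpow_lintegral_le
            (H := fun lam x => levelSum (-γ) (fun k => ‖φ.P (s + γ / p) f (x, k)‖) lam)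
            hmeas ht1
      _ ≤ ∫⁻ x, (C : ℝ≥0∞) ^ (1 / t) * φ.tlFun s r f x ^ p := by
          refine lintegral_mono fun x => ?_
          rw [hG, ← ENNReal.mul_rpow_of_nonneg _ _ (by positivity),
            ← φ.lintegral_levelSum_P (p := p) s γ hr0 hrt f x,
            ← lintegral_const_mul' _ _ ENNReal.coe_ne_top]
          refine ENNReal.rpow_le_rpow (lintegral_mono fun lam => hC _ _) (by positivity)
      _ = (((C ^ (1 / r.toReal) : ℝ≥0) : ℝ≥0∞) *
          (∫⁻ x, φ.tlFun s r f x ^ p) ^ (1 / p)) ^ p := by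
          rw [lintegral_const_mul _ ((φ.measurable_tlFun s r f).pow_const _),
            ENNReal.mul_rpow_of_nonneg _ _ hp.le, ENNReal.coe_rpow_of_nonneg _ (by positivity),
            ← ENNReal.rpow_mul, hexp, one_div p, ENNReal.rpow_inv_rpow hp.ne']

/-- Now `t ≤ 1`, so Minkowski is applied to the `t`-th power of the level sum with exponent `1/t ≥
1` and the roles of `x` and `lam` exchanged. -/
theorem exists_eLpNorm_tlFun_le_lorentzQNorm_P {p : ℝ} (hp : 0 < p) (s : ℝ) {γ : ℝ} (hγ : γ ≠ 0)
    {r : ℝ≥0∞} (hr0 : r ≠ 0) (hr : r ≤ ENNReal.ofReal p) :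
    ∃ C : ℝ≥0, ∀ f : SInftyDual d, eLpNorm (φ.tlFun s r f) (ENNReal.ofReal p) volume ≤
      C * lorentzQNorm (φ.P (s + γ / p) f) p r (muGamma d γ) := by
  have hrt : r ≠ ⊤ := ne_top_of_le_ne_top ENNReal.ofReal_ne_top hr
  have hr' := ENNReal.toReal_pos hr0 hrt
  have hpr : r.toReal ≤ p := ENNReal.toReal_le_of_le_ofReal hp.le hr
  set t := r.toReal / p with ht
  have ht0 : 0 < t := by positivity
  have hq1 : 1 ≤ 1 / t := (one_le_div ht0).mpr ((div_le_one hp).mpr hpr)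
  obtain ⟨C, hC⟩ := exists_levelSum_mul_le (neg_ne_zero.mpr hγ) ht0
  refine ⟨C ^ (1 / r.toReal), fun f => ?_⟩
  have hexp : 1 / p * r.toReal = 1 / (1 / t) := by rw [ht]; field_simp
  have hexp' : r.toReal * (1 / t) = p := by rw [ht]; field_simp
  have hG : ∀ x, φ.tlFun s r f x ^ p = (φ.tlFun s r f x ^ r.toReal) ^ (1 / t) := fun x => by
    rw [← ENNReal.rpow_mul, hexp']
  rw [eLpNorm_tlFun φ hp, ← ENNReal.rpow_le_rpow_iff hr', ENNReal.mul_rpow_of_nonneg _ _ hr'.le,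
    lorentzQNorm_rpow_toReal _ p hr0 hrt, ENNReal.coe_rpow_of_nonneg _ (by positivity),
    one_div r.toReal, ENNReal.rpow_inv_rpow hr'.ne', ← ENNReal.rpow_mul, hexp]
  have hmeas := (φ.measurable_levelSum_P (s + γ / p) (-γ) f).pow_const t
  calc (∫⁻ x, φ.tlFun s r f x ^ p) ^ (1 / (1 / t))
      ≤ (∫⁻ x, (C : ℝ≥0∞) ^ (1 / t) * (∫⁻ lam,
          levelSum (-γ) (fun k => ‖φ.P (s + γ / p) f (x, k)‖) lam ^ t
          ∂powMeasure r.toReal) ^ (1 / t)) ^ (1 / (1 / t)) := by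
        refine ENNReal.rpow_le_rpow (lintegral_mono fun x => ?_) (by positivity)
        rw [hG, ← ENNReal.mul_rpow_of_nonneg _ _ (by positivity),
          ← φ.lintegral_levelSum_P (p := p) s γ hr0 hrt f x,
          ← lintegral_const_mul' _ _ ENNReal.coe_ne_top]
        exact ENNReal.rpow_le_rpow (lintegral_mono fun lam => hC _ _) (by positivity)
    _ = C * (∫⁻ x, (∫⁻ lam, levelSum (-γ) (fun k => ‖φ.P (s + γ / p) f (x, k)‖) lam ^ t
          ∂powMeasure r.toReal) ^ (1 / t)) ^ (1 / (1 / t)) := by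
        rw [lintegral_const_mul' _ _ (by simp [ht0.le]),
          ENNReal.mul_rpow_of_nonneg _ _ (by positivity), one_div (1 / t),
          ENNReal.rpow_rpow_inv (by positivity)]
    _ ≤ C * ∫⁻ lam, (∫⁻ x, (levelSum (-γ) (fun k => ‖φ.P (s + γ / p) f (x, k)‖) lam ^ t) ^ (1 / t))
          ^ (1 / (1 / t)) ∂powMeasure r.toReal := by
        gcongr
        exact lintegral_rpow_lintegral_le
          (H := fun x lam => levelSum (-γ) (fun k => ‖φ.P (s + γ / p) f (x, k)‖) lam ^ t) hmeas hq1
    _ = _ := by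
        simp_rw [distribFn_muGamma_eq_lintegral (φ.measurable_P _ f), one_div_one_div, one_div,
          ENNReal.rpow_rpow_inv ht0.ne', ht]

end LPBump

end LorentzBesov

end

/-! ### The embeddings -/

theorem theorem1p3 {d : ℕ} (hd : 1 ≤ d) (φ : LorentzBesov.LPBump d) (s p : ℝ) (hp : 1 ≤ p) :
    (∀ (γ : ℝ) (r : ℝ≥0∞),
      (ENNReal.ofReal p ≤ r → (φ.calB s p γ r).Embeds (φ.besov s r p r)) ∧
      (1 ≤ r → r ≤ ENNReal.ofReal p → (φ.besov s r p r).Embeds (φ.calB s p γ r))) ∧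
    (∀ (γ : ℝ) (r : ℝ≥0∞), γ ≠ 0 →
      (ENNReal.ofReal p ≤ r → (φ.triebelLizorkin s p r).Embeds (φ.calB s p γ r)) ∧
      (1 ≤ r → r ≤ ENNReal.ofReal p → (φ.calB s p γ r).Embeds (φ.triebelLizorkin s p r))) := by
  have hp0 : 0 < p := by linarith
  have hne : ∀ {r : ℝ≥0∞}, 1 ≤ r → r ≠ 0 := fun h => (zero_lt_one.trans_le h).ne'
  refine ⟨fun γ r => ⟨fun hr => ?_, fun hr1 hr => ?_⟩, fun γ r hγ => ⟨fun hr => ?_, fun hr1 hr => ?_⟩⟩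
  · have hle := φ.besovQNorm_le_lorentzQNorm_P hp0 s γ hr
    refine ⟨fun f hf => ?_, 1, fun f _ => by simpa using! hle f⟩
    have hfin : φ.besovQNorm s r p r f < ⊤ := (hle f).trans_lt hf.2
    refine ⟨fun k => ⟨(φ.continuous_L f k).aestronglyMeasurable, ?_⟩, hfin⟩
    have hr0 : r ≠ 0 := ((ENNReal.ofReal_pos.mpr hp0).trans_le hr).ne'
    -- Membership also asks that each `L_k f` lie in `L^{p,r}`: one term is at most the `ℓ^r` norm,
    -- and its weight `2^{ks}` is nonzero.
    have hk := (LorentzBesov.le_lqNorm hr0 (fun k : ℤ => ENNReal.ofReal ((2 : ℝ) ^ ((k : ℝ) * s)) *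
      LorentzBesov.lorentzQNorm (φ.L f k) p r volume) k).trans_lt hfin
    refine ENNReal.lt_top_of_mul_ne_top_right hk.ne ?_
    rw [Ne, ENNReal.ofReal_eq_zero, not_le]
    positivity
  · have hle := φ.lorentzQNorm_P_le_besovQNorm hp0 s γ (hne hr1) hr
    exact ⟨fun f hf => ⟨(φ.measurable_P _ f).aestronglyMeasurable, (hle f).trans_lt hf.2⟩, 1,
      fun f _ => by simpa using! hle f⟩
  · obtain ⟨C, hC⟩ := φ.exists_lorentzQNorm_P_le_eLpNorm_tlFun hp0 s hγ hr
    exact ⟨fun f hf => ⟨(φ.measurable_P _ f).aestronglyMeasurable,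
      (hC f).trans_lt (ENNReal.mul_lt_top ENNReal.coe_lt_top hf.2)⟩, C, fun f _ => hC f⟩
  · obtain ⟨C, hC⟩ := φ.exists_eLpNorm_tlFun_le_lorentzQNorm_P hp0 s hγ (hne hr1) hr
    exact ⟨fun f hf => ⟨(φ.measurable_tlFun s r f).aestronglyMeasurable,
      (hC f).trans_lt (ENNReal.mul_lt_top ENNReal.coe_lt_top hf.2)⟩, C, fun f _ => hC f⟩
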